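/- Let $\mathcal G_n$ denote the $n$-qubit Pauli group, i.e. the group of unitaries $c\,\sigma_1\otimes\cdots\otimes\sigma_n$ on $(\mathbb C^2)^{\otimes n}$ with $c\in\{\pm1,\pm i\}$ and each $\sigma_j\in\{I,X,Y,Z\}$. Let $S\subset\mathcal G_n$ be an abelian subgroup with $-I\notin S$ having $n-k$ independent generators, let $\mathcal C$ be the associated $[n,k]$ stabiliser code (the joint $+1$ eigenspace of the elements of $S$), let $N(S)$ be the normaliser of $S$ in $\mathcal G_n$, and let $\phi_S:N(S)\to N(S)/S$ be the quotient map. Write $\overline{\mathcal G}_k$ for the logical Pauli group, a copy of the $k$-qubit Pauli group. Let $E\subset\mathcal G_n$ be a set of physical errors and let $\overline M$ be a subgroup of $\overline{\mathcal G}_k$. For a group isomorphism $\mathcal A:\overline{\mathcal G}_k\to N(S)/S$, an \emph{admissible logical noise channel} is a quantum channel (completely positive trace-preserving map) on $n$ qubits which maps states supported in $\mathcal C$ to states supported in $\mathcal C$ and has a Kraus representation whose Kraus operators are all proportional to elements of the lift $M=\phi_S^{-1}(\mathcal A(\overline M))\subset\mathcal G_n$. The code $\mathcal C$ is a \emph{quantum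 error transmuting code} for $\{E,\overline M\}$ if, for some isomorphism $\mathcal A$, there is a single quantum channel $\mathcal R$ such that for every quantum channel $\mathcal E$ having a Kraus representation with all Kraus operators proportional to elements of $E$, there is an admissible logical noise channel $\mathcal M$ with $\mathcal R(\mathcal E(\rho))=\mathcal M(\rho)$ for all density operators $\rho$ with support in $\mathcal C$. Then $\mathcal C$ is a quantum error transmuting code for $\{E,\overline M\}$ if and only if there exists an isomorphism $\mathcal A:\overline{\mathcal G}_k\to N(S)/S$ such that, with $M=\phi_S^{-1}(\mathcal A(\overline M))$, every pair $E_j,E_k\in E$ satisfies $$E_j^\dagger E_k\in(\mathcal G_n\setminus N(S))\cup M,$$ where membership in $M$ is understood up to a global phase in $\{\pm1,\pm i\}$. -/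

import Mathlib

open scoped Matrix ComplexOrder

noncomputable section

namespace QET

/-- The computational basis of `n` qubits; the Hilbert space `(ℂ²)^{⊗n}` is the space of
functions `Basis n → ℂ`. -/
abbrev Basis (n : ℕ) : Type := Fin n → Fin 2

/-- Operators on `n` qubits. -/
abbrev Op (n : ℕ) : Type := Matrix (Basis n) (Basis n) ℂ

/-- The four single-qubit Pauli matrices `I, X, Y, Z`. -/
def sigma : Fin 4 → Matrix (Fin 2) (Fin 2) ℂ :=
  ![!![1, 0; 0, 1], !![0, 1; 1, 0], !![0, -Complex.I; Complex.I, 0], !![1, 0; 0, -1]]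

/-- The tensor product of `n` single-qubit operators. -/
def tensor {n : ℕ} (A : Fin n → Matrix (Fin 2) (Fin 2) ℂ) : Op n :=
  Matrix.of fun x y => ∏ j, A j (x j) (y j)

/-- The global phases `±1, ±i`. -/
def IsPhase (c : ℂ) : Prop := c = 1 ∨ c = -1 ∨ c = Complex.I ∨ c = -Complex.I

theorem IsPhase.mul {c d : ℂ} (hc : IsPhase c) (hd : IsPhase d) : IsPhase (c * d) := by
  unfold IsPhase at *
  rcases hc with rfl | rfl | rfl | rfl <;> rcases hd with rfl | rfl | rfl | rfl <;> simp

theorem IsPhase.star {c : ℂ} (hc : IsPhase c) : IsPhase (star c) := by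
  unfold IsPhase at *
  rcases hc with rfl | rfl | rfl | rfl <;> simp

theorem tensor_mul {n : ℕ} (A B : Fin n → Matrix (Fin 2) (Fin 2) ℂ) :
    tensor A * tensor B = tensor fun j => A j * B j := by
  ext x y
  simp only [tensor, Matrix.mul_apply, Matrix.of_apply, ← Finset.prod_mul_distrib]
  exact (Fintype.prod_sum fun j z => A j (x j) z * B j z (y j)).symm

theorem tensor_smul {n : ℕ} (c : Fin n → ℂ) (A : Fin n → Matrix (Fin 2) (Fin 2) ℂ) :
    (tensor fun j => c j • A j) = (∏ j, c j) • tensor A := by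
  ext x y
  simp [tensor, Finset.prod_mul_distrib]

theorem tensor_conjTranspose {n : ℕ} (A : Fin n → Matrix (Fin 2) (Fin 2) ℂ) :
    (tensor A)ᴴ = tensor fun j => (A j)ᴴ := by
  ext x y
  simp [tensor, Matrix.conjTranspose_apply]

theorem tensor_one {n : ℕ} : (tensor fun _ : Fin n => sigma 0) = 1 := by
  ext x y
  by_cases h : x = y
  · subst h
    have : ∀ i : Fin 2, sigma 0 i i = 1 := by
      intro i; fin_cases i <;> simp [sigma]
    simp [tensor, this]
  · obtain ⟨j, hj⟩ := Function.ne_iff.mp h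
    have : ∀ a b : Fin 2, a ≠ b → sigma 0 a b = 0 := by
      intro a b; fin_cases a <;> fin_cases b <;> simp [sigma]
    simp only [tensor, Matrix.of_apply, Matrix.one_apply_ne h]
    exact Finset.prod_eq_zero (Finset.mem_univ j) (this _ _ hj)

theorem sigma_conjTranspose (a : Fin 4) : (sigma a)ᴴ = sigma a := by
  fin_cases a <;> ext i j <;> fin_cases i <;> fin_cases j <;>
    simp [sigma, Matrix.conjTranspose_apply]

theorem sigma_mul (a b : Fin 4) :
    ∃ (c : ℂ) (d : Fin 4), IsPhase c ∧ sigma a * sigma b = c • sigma d := by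
  have key : ∀ (c : ℂ) (d : Fin 4), IsPhase c → sigma a * sigma b = c • sigma d →
      ∃ (c : ℂ) (d : Fin 4), IsPhase c ∧ sigma a * sigma b = c • sigma d :=
    fun c d h1 h2 => ⟨c, d, h1, h2⟩
  fin_cases a <;> fin_cases b
  · exact key 1 0 (by simp [IsPhase]) (by simp [sigma])
  · exact key 1 1 (by simp [IsPhase]) (by simp [sigma])
  · exact key 1 2 (by simp [IsPhase]) (by simp [sigma])
  · exact key 1 3 (by simp [IsPhase]) (by simp [sigma])
  · exact key 1 1 (by simp [IsPhase]) (by simp [sigma])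
  · exact key 1 0 (by simp [IsPhase]) (by simp [sigma])
  · exact key Complex.I 3 (by simp [IsPhase]) (by simp [sigma])
  · exact key (-Complex.I) 2 (by simp [IsPhase]) (by simp [sigma])
  · exact key 1 2 (by simp [IsPhase]) (by simp [sigma])
  · exact key (-Complex.I) 3 (by simp [IsPhase]) (by simp [sigma])
  · exact key 1 0 (by simp [IsPhase]) (by simp [sigma])
  · exact key Complex.I 1 (by simp [IsPhase]) (by simp [sigma])
  · exact key 1 3 (by simp [IsPhase]) (by simp [sigma])
  · exact key Complex.I 2 (by simp [IsPhase]) (by simp [sigma])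
  · exact key (-Complex.I) 1 (by simp [IsPhase]) (by simp [sigma])
  · exact key 1 0 (by simp [IsPhase]) (by simp [sigma])

theorem isPhase_prod {n : ℕ} (c : Fin n → ℂ) (hc : ∀ j, IsPhase (c j)) :
    IsPhase (∏ j, c j) :=
  Finset.prod_induction c IsPhase (fun _ _ => IsPhase.mul) (Or.inl rfl) fun j _ => hc j

/-- The `n`-qubit Pauli group: all `c σ_{p 0} ⊗ ⋯ ⊗ σ_{p (n-1)}` with `c ∈ {±1, ±i}`. -/
def pauliGroup (n : ℕ) : Subgroup (Matrix.unitaryGroup (Basis n) ℂ) where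
  carrier := {U | ∃ (c : ℂ) (p : Fin n → Fin 4), IsPhase c ∧
    (U : Op n) = c • tensor fun j => sigma (p j)}
  one_mem' := ⟨1, fun _ => 0, Or.inl rfl, by simp [tensor_one]⟩
  mul_mem' := by
    rintro U V ⟨c, p, hc, hU⟩ ⟨d, q, hd, hV⟩
    choose e r he hr using fun j => sigma_mul (p j) (q j)
    refine ⟨c * d * ∏ j, e j, r, (hc.mul hd).mul (isPhase_prod e he), ?_⟩
    rw [Submonoid.coe_mul, hU, hV, smul_mul_smul_comm, tensor_mul]
    simp only [hr, tensor_smul, smul_smul]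
  inv_mem' := by
    rintro U ⟨c, p, hc, hU⟩
    refine ⟨star c, p, hc.star, ?_⟩
    rw [Matrix.UnitaryGroup.inv_val, Matrix.star_eq_conjTranspose, hU,
      Matrix.conjTranspose_smul, tensor_conjTranspose]
    simp only [sigma_conjTranspose]

/-- The operator on `n` qubits given by an element of the Pauli group. -/
def toOp {n : ℕ} (g : pauliGroup n) : Op n := (g : Matrix.unitaryGroup (Basis n) ℂ)

theorem toOp_inv {n : ℕ} (g : pauliGroup n) : toOp g⁻¹ = (toOp g)ᴴ := rfl

/-- `S` is the stabiliser of an `[n, k]` stabiliser code: an abelian subgroup of the Pauli group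
which does not contain `-I` and has `n - k` independent generators. -/
structure IsStabiliser (n k : ℕ) (S : Subgroup (pauliGroup n)) : Prop where
  comm : ∀ a ∈ S, ∀ b ∈ S, a * b = b * a
  neg_one_notMem : ∀ g ∈ S, toOp g ≠ -1
  generators : ∃ r : ℕ, r + k = n ∧ ∃ g : Fin r → pauliGroup n,
    Subgroup.closure (Set.range g) = S ∧ ∀ l, g l ∉ Subgroup.closure (g '' {l}ᶜ)

/-- The code space: the joint `+1` eigenspace of the elements of `S`. -/
def codeSpace {n : ℕ} (S : Subgroup (pauliGroup n)) : Submodule ℂ (Basis n → ℂ) where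
  carrier := {v | ∀ g ∈ S, toOp g *ᵥ v = v}
  zero_mem' := fun g _ => Matrix.mulVec_zero (toOp g)
  add_mem' := fun {v w} hv hw g hg => by rw [Matrix.mulVec_add, hv g hg, hw g hg]
  smul_mem' := fun c v hv g hg => by rw [Matrix.mulVec_smul, hv g hg]

/-- `ρ` is a density operator. -/
def IsDensity {n : ℕ} (ρ : Op n) : Prop := ρ.PosSemidef ∧ ρ.trace = 1

/-- The Hermitian operator `ρ` has support (that is, range) inside the subspace `C`. -/
def SupportedIn {n : ℕ} (C : Submodule ℂ (Basis n → ℂ)) (ρ : Op n) : Prop :=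
  ∀ v, ρ *ᵥ v ∈ C

/-- `Φ` is a quantum channel (completely positive and trace preserving) which has a Kraus
representation all of whose Kraus operators are proportional to elements of `T`. -/
def IsChannelWithKrausIn {n : ℕ} (T : Set (Op n)) (Φ : Op n → Op n) : Prop :=
  ∃ (r : ℕ) (K : Fin r → Op n),
    (∀ i, ∃ (c : ℂ), ∃ t ∈ T, K i = c • t) ∧
    ∑ i, (K i)ᴴ * K i = 1 ∧
    ∀ ρ, Φ ρ = ∑ i, K i * ρ * (K i)ᴴ

/-- A quantum channel: a map with a Kraus representation, with arbitrary Kraus operators. -/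
def IsChannel {n : ℕ} (Φ : Op n → Op n) : Prop := IsChannelWithKrausIn Set.univ Φ

/-- The quotient `N(S)/S`, where `N(S)` is the normaliser of `S` in the Pauli group. -/
abbrev LogicalQuotient {n : ℕ} (S : Subgroup (pauliGroup n)) : Type :=
  Subgroup.normalizer (S : Set (pauliGroup n)) ⧸
    S.subgroupOf (Subgroup.normalizer (S : Set (pauliGroup n)))

/-- The lift `M = φ_S⁻¹(A(M̄))`: the union, as a subset of the Pauli group, of the cosets of `S`
in `N(S)` that belong to `A(M̄)`. -/
def lift {n k : ℕ} (S : Subgroup (pauliGroup n)) (A : pauliGroup k ≃* LogicalQuotient S)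
    (M : Set (pauliGroup k)) : Set (pauliGroup n) :=
  {g | ∃ h : g ∈ Subgroup.normalizer (S : Set (pauliGroup n)),
    (QuotientGroup.mk ⟨g, h⟩ : LogicalQuotient S) ∈ A '' M}

/-- The elements of the Pauli group that agree with an element of `T` up to a global phase
`±1, ±i`. -/
def upToPhase {n : ℕ} (T : Set (pauliGroup n)) : Set (pauliGroup n) :=
  {g | ∃ t ∈ T, ∃ c : ℂ, IsPhase c ∧ toOp g = c • toOp t}

/-- Admissible logical noise channels: channels stabilising the code space, with Kraus operators
proportional to elements of the cosets in `A(M̄)`. -/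
def IsALNC {n k : ℕ} (S : Subgroup (pauliGroup n)) (A : pauliGroup k ≃* LogicalQuotient S)
    (M : Set (pauliGroup k)) (Φ : Op n → Op n) : Prop :=
  IsChannelWithKrausIn (toOp '' lift S A M) Φ ∧
    ∀ ρ, IsDensity ρ → SupportedIn (codeSpace S) ρ → SupportedIn (codeSpace S) (Φ ρ)

/-- The code with stabiliser `S` is a quantum error transmuting code for the physical errors `E`
and the admissible logical errors `M`: for a choice of isomorphism `A` there is a single recovery
channel `R` which turns every noise channel with Kraus operators proportional to elements of `E`
into an admissible logical noise channel on the states of the code. -/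
def IsQETC {n k : ℕ} (S : Subgroup (pauliGroup n)) (E : Set (pauliGroup n))
    (M : Set (pauliGroup k)) : Prop :=
  ∃ A : pauliGroup k ≃* LogicalQuotient S, ∃ R : Op n → Op n, IsChannel R ∧
    ∀ N : Op n → Op n, IsChannelWithKrausIn (toOp '' E) N →
      ∃ L : Op n → Op n, IsALNC S A M L ∧
        ∀ ρ, IsDensity ρ → SupportedIn (codeSpace S) ρ → R (N ρ) = L ρ

end QET

end

open scoped Matrix ComplexOrder

namespace QET

variable {n k : ℕ}

/-! Let `P` be the code projection, the average of the stabiliser. Two Pauli operators commute or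
anticommute, so `P g P = 0` for `g` outside `N(S)` (`proj_mul_toOp_mul_proj`), while `g` in `N(S)`
commutes with `P`.

Sufficiency: the images `a C` for errors `a` in distinct cosets of `N(S)` are orthogonal. Measuring
the coset and undoing one chosen representative `a` turns an error `b` of that coset into `a⁻¹ b`
(`exists_recovery`). This lies in `N(S)`, hence in the lift up to a phase, and phases cancel under
conjugation.

Necessity: suppose `g = a⁻¹ b` lies in `N(S)`. Then `b ρ b†` is `a` acting on the code state `g ρ
g†`, so the logical channel obtained for `a`, precomposed with `g`, agrees on the code with the one
obtained for `b`. Both are mixtures of Pauli conjugations. Polarisation (`eq_on_proj_mul_mul_proj`)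
and a weight that detects a Kraus operator (`krausWeight_conjMap`) yield `t`, `u` in the lift with
`u† t g` of nonzero trace on the code. Such an operator is a phase times a stabiliser element, so
`g` is in the lift up to a phase. -/

theorem IsPhase.star_mul_self_eq_one {c : ℂ} (hc : IsPhase c) : Star.star c * c = 1 := by
  rcases hc with rfl | rfl | rfl | rfl <;> simp

/-! ### Commutation and traces of Pauli operators -/

theorem toOp_mul (g h : pauliGroup n) : toOp (g * h) = toOp g * toOp h := rfl

theorem toOp_one : toOp (1 : pauliGroup n) = 1 := rfl

theorem toOp_injective : Function.Injective (toOp : pauliGroup n → Op n) :=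
  fun _ _ h => Subtype.ext (Subtype.ext h)

theorem toOp_conjTranspose_mul_self (g : pauliGroup n) : (toOp g)ᴴ * toOp g = 1 := by
  rw [← toOp_inv, ← toOp_mul, inv_mul_cancel, toOp_one]

theorem exists_toOp_eq (g : pauliGroup n) :
    ∃ (c : ℂ) (p : Fin n → Fin 4), IsPhase c ∧ toOp g = c • tensor fun j => sigma (p j) :=
  g.2

instance : Finite (pauliGroup n) := by
  have hfin : {c : ℂ | IsPhase c}.Finite :=
    (Set.toFinite {1, -1, Complex.I, -Complex.I}).subset fun c hc => hc
  have : Finite {c : ℂ | IsPhase c} := hfin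
  choose c p hc hp using fun g : pauliGroup n => exists_toOp_eq g
  refine Finite.of_injective
    (fun g => ((⟨c g, hc g⟩, p g) : {c : ℂ | IsPhase c} × (Fin n → Fin 4))) fun g h hgh => ?_
  obtain ⟨h1, h2⟩ := Prod.ext_iff.mp hgh
  apply toOp_injective
  rw [hp g, hp h, show c g = c h from congrArg Subtype.val h1, show p g = p h from h2]

theorem sigma_mul_comm (a b : Fin 4) :
    ∃ e : ℂ, (e = 1 ∨ e = -1) ∧ sigma a * sigma b = e • (sigma b * sigma a) := by
  fin_cases a <;> fin_cases b <;>
    first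
    | (refine ⟨1, Or.inl rfl, ?_⟩; simp [sigma]; done)
    | (refine ⟨-1, Or.inr rfl, ?_⟩; simp [sigma])

/-- The signs from the tensor factors multiply to a single sign. -/
theorem toOp_mul_comm (g h : pauliGroup n) :
    toOp g * toOp h = toOp h * toOp g ∨ toOp g * toOp h = -(toOp h * toOp g) := by
  obtain ⟨c, p, -, hg⟩ := exists_toOp_eq g
  obtain ⟨d, q, -, hh⟩ := exists_toOp_eq h
  choose e he hs using fun j => sigma_mul_comm (p j) (q j)
  have hprod : (∏ j, e j) = 1 ∨ (∏ j, e j) = -1 :=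
    Finset.prod_induction e (fun z => z = 1 ∨ z = -1)
      (by rintro _ _ (rfl | rfl) (rfl | rfl) <;> simp) (Or.inl rfl) fun j _ => he j
  have key : toOp g * toOp h = (∏ j, e j) • (toOp h * toOp g) := by
    rw [hg, hh, smul_mul_smul_comm, smul_mul_smul_comm, tensor_mul, tensor_mul]
    simp only [hs, tensor_smul, smul_smul]
    congr 1
    ring
  rcases hprod with h1 | h1 <;> rw [h1] at key
  · left; simpa using key
  · right; simpa using key

theorem trace_tensor (A : Fin n → Matrix (Fin 2) (Fin 2) ℂ) :
    (tensor A).trace = ∏ j, (A j).trace := by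
  simp only [Matrix.trace, Matrix.diag, tensor, Matrix.of_apply]
  exact (Fintype.prod_sum fun j x => A j x x).symm

theorem trace_sigma (a : Fin 4) (ha : a ≠ 0) : (sigma a).trace = 0 := by
  fin_cases a <;> simp [sigma, Matrix.trace] at *

/-- A Pauli operator of nonzero trace is a phase. -/
theorem exists_eq_smul_one_of_trace_ne_zero {g : pauliGroup n} (hg : (toOp g).trace ≠ 0) :
    ∃ c, IsPhase c ∧ toOp g = c • 1 := by
  obtain ⟨c, p, hc, hp⟩ := exists_toOp_eq g
  have h0 : ∀ j, p j = 0 := by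
    intro j
    by_contra hj
    apply hg
    rw [hp, Matrix.trace_smul, trace_tensor,
      Finset.prod_eq_zero (Finset.mem_univ j) (trace_sigma _ hj), smul_zero]
  refine ⟨c, hc, ?_⟩
  rw [hp, ← tensor_one]
  simp only [h0]

/-- Otherwise `g` is a phase other than `1`, and then `g` or `g²` equals `-I`. -/
theorem IsStabiliser.trace_eq_zero {S : Subgroup (pauliGroup n)} (hS : IsStabiliser n k S)
    {g : pauliGroup n} (hg : g ∈ S) (h1 : g ≠ 1) : (toOp g).trace = 0 := by
  by_contra ht
  obtain ⟨c, hc, hgc⟩ := exists_eq_smul_one_of_trace_ne_zero ht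
  have hsq : toOp (g * g) = (c * c) • (1 : Op n) := by
    rw [toOp_mul, hgc, smul_mul_smul_comm, one_mul]
  rcases hc with rfl | rfl | rfl | rfl
  · exact h1 (toOp_injective (by rw [hgc, one_smul, toOp_one]))
  · exact hS.neg_one_notMem g hg (by simp [hgc])
  · exact hS.neg_one_notMem _ (S.mul_mem hg hg) (by simp [hsq])
  · exact hS.neg_one_notMem _ (S.mul_mem hg hg) (by simp [hsq])

/-! ### The code projection -/

noncomputable instance (S : Subgroup (pauliGroup n)) : Fintype S := Fintype.ofFinite S

/-- The projection onto the code space: the average of the stabiliser. -/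
noncomputable def proj (S : Subgroup (pauliGroup n)) : Op n :=
  (Nat.card S : ℂ)⁻¹ • ∑ s : S, toOp (s : pauliGroup n)

section Projection

variable {S : Subgroup (pauliGroup n)}

theorem card_ne_zero : (Nat.card S : ℂ) ≠ 0 := by
  exact_mod_cast Nat.card_pos.ne'

theorem toOp_mul_proj {s : pauliGroup n} (hs : s ∈ S) : toOp s * proj S = proj S := by
  unfold proj
  rw [Matrix.mul_smul, Finset.mul_sum]
  congr 1
  exact Fintype.sum_equiv (Equiv.mulLeft ⟨s, hs⟩) _ _ fun t => rfl

theorem proj_mul_toOp {s : pauliGroup n} (hs : s ∈ S) : proj S * toOp s = proj S := by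
  unfold proj
  rw [Matrix.smul_mul, Finset.sum_mul]
  congr 1
  exact Fintype.sum_equiv (Equiv.mulRight ⟨s, hs⟩) _ _ fun t => rfl

theorem proj_conjTranspose : (proj S)ᴴ = proj S := by
  unfold proj
  rw [Matrix.conjTranspose_smul, Matrix.conjTranspose_sum]
  congr 1
  · simp
  · exact Fintype.sum_equiv (Equiv.inv S) _ _ fun t => rfl

theorem proj_mul_self : proj S * proj S = proj S := by
  conv_lhs => enter [1]; unfold proj
  rw [Matrix.smul_mul, Finset.sum_mul,
    Finset.sum_congr rfl fun s _ => toOp_mul_proj (S := S) s.2, Finset.sum_const,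
    Finset.card_univ, ← Nat.card_eq_fintype_card, ← Nat.cast_smul_eq_nsmul ℂ, smul_smul,
    inv_mul_cancel₀ card_ne_zero, one_smul]

/-- Elements of the normaliser commute with the projection. -/
theorem toOp_mul_proj_comm {g : pauliGroup n}
    (hg : g ∈ Subgroup.normalizer (S : Set (pauliGroup n))) :
    toOp g * proj S = proj S * toOp g := by
  unfold proj
  rw [Matrix.mul_smul, Matrix.smul_mul, Finset.mul_sum, Finset.sum_mul]
  congr 1
  let e : S ≃ S :=
    (MulAut.conj g).toEquiv.subtypeEquiv fun h => (Subgroup.mem_normalizer_iff.mp hg) h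
  refine Fintype.sum_equiv e _ _ fun t => ?_
  rw [← toOp_mul, ← toOp_mul]
  congr 1
  simp [e]

/-- Errors outside of the normaliser map the code to an orthogonal subspace. -/
theorem proj_mul_toOp_mul_proj {g : pauliGroup n}
    (hg : g ∉ Subgroup.normalizer (S : Set (pauliGroup n))) :
    proj S * toOp g * proj S = 0 := by
  -- An element commuting with all of `S` would normalise it, so some `s` anticommutes with `g`;
  -- moving `s` from one projection to the other flips the sign.
  have hs : ∃ s ∈ S, toOp g * toOp s ≠ toOp s * toOp g := by
    by_contra! hcomm
    have hc : ∀ s ∈ S, g * s = s * g := fun s hs => toOp_injective (hcomm s hs)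
    refine hg (Subgroup.mem_normalizer_iff.mpr fun h => ⟨fun hh => ?_, fun hh => ?_⟩)
    · rwa [hc h hh, mul_inv_cancel_right]
    · have h2 := hc _ hh
      have h3 : g * h * g⁻¹ = h := mul_left_cancel (h2.trans (inv_mul_cancel_right _ _))
      rwa [h3] at hh
  obtain ⟨s, hs, hne⟩ := hs
  have hanti := (toOp_mul_comm g s).resolve_left hne
  have : proj S * toOp g * proj S = -(proj S * toOp g * proj S) := by
    calc proj S * toOp g * proj S = proj S * toOp g * (toOp s * proj S) := by
          rw [toOp_mul_proj hs]
      _ = proj S * (toOp g * toOp s) * proj S := by simp only [mul_assoc]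
      _ = -((proj S * toOp s) * toOp g * proj S) := by rw [hanti]; simp [mul_assoc]
      _ = -(proj S * toOp g * proj S) := by rw [proj_mul_toOp hs]
  ext x y
  exact self_eq_neg.mp (congrFun (congrFun this x) y)

theorem proj_mulVec_mem (v : Basis n → ℂ) : proj S *ᵥ v ∈ codeSpace S := fun s hs => by
  rw [Matrix.mulVec_mulVec, toOp_mul_proj hs]

theorem proj_mulVec_eq {v : Basis n → ℂ} (hv : v ∈ codeSpace S) : proj S *ᵥ v = v := by
  unfold proj
  rw [Matrix.smul_mulVec, Matrix.sum_mulVec, Finset.sum_congr rfl fun (s : S) _ => hv s s.2,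
    Finset.sum_const, Finset.card_univ, ← Nat.card_eq_fintype_card, ← Nat.cast_smul_eq_nsmul ℂ,
    smul_smul, inv_mul_cancel₀ card_ne_zero, one_smul]

theorem supportedIn_codeSpace_iff {ρ : Op n} :
    SupportedIn (codeSpace S) ρ ↔ proj S * ρ = ρ := by
  constructor
  · intro h
    refine Matrix.ext_of_mulVec_single fun x => ?_
    rw [← Matrix.mulVec_mulVec, proj_mulVec_eq (h _)]
  · intro h v
    rw [← h, ← Matrix.mulVec_mulVec]
    exact proj_mulVec_mem _

theorem SupportedIn.mul_proj {ρ : Op n} (hρ : ρ.IsHermitian)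
    (h : SupportedIn (codeSpace S) ρ) : ρ * proj S = ρ := by
  have := congrArg Matrix.conjTranspose (supportedIn_codeSpace_iff.mp h)
  rwa [Matrix.conjTranspose_mul, hρ.eq, proj_conjTranspose] at this

theorem SupportedIn.conj {ρ : Op n} (h : SupportedIn (codeSpace S) ρ) {g : pauliGroup n}
    (hg : g ∈ Subgroup.normalizer (S : Set (pauliGroup n))) :
    SupportedIn (codeSpace S) (toOp g * ρ * (toOp g)ᴴ) := by
  rw [supportedIn_codeSpace_iff] at *
  rw [← mul_assoc, ← mul_assoc, ← toOp_mul_proj_comm hg, mul_assoc (toOp g), h]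

theorem IsDensity.conj {ρ : Op n} (h : IsDensity ρ) (g : pauliGroup n) :
    IsDensity (toOp g * ρ * (toOp g)ᴴ) :=
  ⟨h.1.mul_mul_conjTranspose_same _, by
    rw [Matrix.trace_mul_comm, ← mul_assoc, toOp_conjTranspose_mul_self, one_mul, h.2]⟩

/-- Only the identity contributes to the trace of the average, so the code is nonzero. -/
theorem IsStabiliser.trace_proj_ne_zero (hS : IsStabiliser n k S) : (proj S).trace ≠ 0 := by
  have : (proj S).trace = (Nat.card S : ℂ)⁻¹ * (1 : Op n).trace := by
    unfold proj
    rw [Matrix.trace_smul, Matrix.trace_sum, smul_eq_mul, Finset.sum_eq_single (1 : S)]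
    · rfl
    · intro s _ hs
      exact hS.trace_eq_zero s.2 fun h => hs (Subtype.ext h)
    · simp
  rw [this]
  exact mul_ne_zero (inv_ne_zero card_ne_zero) (by simp)

/-- A Pauli operator which has a nonzero trace on the code is, up to a phase, in the stabiliser. -/
theorem exists_mem_of_trace_mul_proj_ne_zero {u : pauliGroup n}
    (hu : (toOp u * proj S).trace ≠ 0) : ∃ s ∈ S, ∃ c, IsPhase c ∧ toOp u = c • toOp s := by
  have : ∃ s : S, (toOp u * toOp (s : pauliGroup n)).trace ≠ 0 := by
    by_contra! h
    apply hu
    unfold proj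
    rw [Matrix.mul_smul, Finset.mul_sum, Matrix.trace_smul, Matrix.trace_sum,
      Finset.sum_eq_zero fun s _ => h s, smul_zero]
  obtain ⟨s, hs⟩ := this
  obtain ⟨c, hc, h⟩ := exists_eq_smul_one_of_trace_ne_zero (g := u * (s : pauliGroup n)) hs
  refine ⟨(s : pauliGroup n)⁻¹, S.inv_mem s.2, c, hc, ?_⟩
  calc toOp u = toOp (u * (s : pauliGroup n)) * toOp (s : pauliGroup n)⁻¹ := by
        rw [← toOp_mul, mul_inv_cancel_right]
    _ = c • toOp (s : pauliGroup n)⁻¹ := by rw [h, Matrix.smul_mul, one_mul]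

end Projection

/-! ### The lift as a subgroup containing the stabiliser -/

section Lift

variable {S : Subgroup (pauliGroup n)}

/-- The lift of a subgroup, as a subgroup of the Pauli group. -/
noncomputable def liftSubgroup (S : Subgroup (pauliGroup n))
    (A : pauliGroup k ≃* LogicalQuotient S) (M : Subgroup (pauliGroup k)) :
    Subgroup (pauliGroup n) :=
  ((M.map A.toMonoidHom).comap (QuotientGroup.mk' _)).map (Subgroup.subtype _)

theorem coe_liftSubgroup (A : pauliGroup k ≃* LogicalQuotient S) (M : Subgroup (pauliGroup k)) :
    (liftSubgroup S A M : Set (pauliGroup n)) = lift S A M := by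
  ext g
  constructor
  · rintro ⟨⟨g, hg⟩, hm, rfl⟩
    exact ⟨hg, hm⟩
  · rintro ⟨hg, hm⟩
    exact ⟨⟨g, hg⟩, hm, rfl⟩

theorem le_liftSubgroup (A : pauliGroup k ≃* LogicalQuotient S) (M : Subgroup (pauliGroup k)) :
    S ≤ liftSubgroup S A M := by
  intro s hs
  refine ⟨⟨s, Subgroup.le_normalizer hs⟩, ⟨1, M.one_mem, ?_⟩, rfl⟩
  rw [map_one]
  exact ((QuotientGroup.eq_one_iff _).mpr (Subgroup.mem_subgroupOf.mpr hs)).symm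

end Lift

/-! ### Pauli channels, polarisation and Kraus weights -/

section Channels

theorem isChannelWithKrausIn_of_fintype {ι : Type*} [Fintype ι] {T : Set (Op n)} (K : ι → Op n)
    (hT : ∀ i, ∃ c : ℂ, ∃ t ∈ T, K i = c • t) (hK : ∑ i, (K i)ᴴ * K i = 1) :
    IsChannelWithKrausIn T fun ρ => ∑ i, K i * ρ * (K i)ᴴ := by
  let e := Fintype.equivFin ι
  refine ⟨Fintype.card ι, K ∘ e.symm, fun i => hT _, ?_, fun ρ => ?_⟩
  · rw [← hK]
    exact Fintype.sum_equiv e.symm _ _ fun _ => rfl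
  · exact (Fintype.sum_equiv e.symm _ _ fun _ => rfl).symm

theorem isChannelWithKrausIn_conj {T : Set (pauliGroup n)} {g : pauliGroup n} (hg : g ∈ T) :
    IsChannelWithKrausIn (toOp '' T) fun ρ => toOp g * ρ * (toOp g)ᴴ := by
  refine ⟨1, fun _ => toOp g, fun _ => ⟨1, _, ⟨g, hg, rfl⟩, (one_smul _ _).symm⟩, ?_, ?_⟩
  · simp [toOp_conjTranspose_mul_self]
  · simp

/-- A channel with Kraus operators proportional to elements of a set of Pauli operators is a
probabilistic mixture of their conjugations. -/
theorem IsChannelWithKrausIn.exists_pauli {T : Set (pauliGroup n)} {Φ : Op n → Op n}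
    (h : IsChannelWithKrausIn (toOp '' T) Φ) :
    ∃ (r : ℕ) (c : Fin r → ℂ) (t : Fin r → pauliGroup n), (∀ i, t i ∈ T) ∧
      ∑ i, star (c i) * c i = 1 ∧
      ∀ ρ, Φ ρ = ∑ i, (star (c i) * c i) • (toOp (t i) * ρ * (toOp (t i))ᴴ) := by
  obtain ⟨r, K, hK, h1, hΦ⟩ := h
  choose c u hu hcu using hK
  choose t ht htu using hu
  have hKi : ∀ i, K i = c i • toOp (t i) := fun i => by rw [hcu, htu]
  refine ⟨r, c, t, ht, ?_, fun ρ => ?_⟩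
  · have h2 : (∑ i, star (c i) * c i) • (1 : Op n) = 1 := by
      rw [Finset.sum_smul]
      refine Eq.trans ?_ h1
      refine Finset.sum_congr rfl fun i _ => ?_
      rw [hKi, Matrix.conjTranspose_smul, smul_mul_smul_comm, toOp_conjTranspose_mul_self]
    -- Compare one diagonal entry, at the all-zero basis state, which exists even for `n = 0`.
    have h3 := congrFun (congrFun h2 0) 0
    simpa using h3
  · rw [hΦ]
    refine Finset.sum_congr rfl fun i _ => ?_
    rw [hKi, Matrix.conjTranspose_smul, Matrix.smul_mul, Matrix.smul_mul, Matrix.mul_smul,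
      smul_smul, mul_comm]

/-- Linear maps which agree on the states of the code agree on all operators on the code. -/
theorem eq_on_proj_mul_mul_proj {S : Subgroup (pauliGroup n)} (F : Op n →ₗ[ℂ] Op n)
    (hF : ∀ ρ, IsDensity ρ → SupportedIn (codeSpace S) ρ → F ρ = 0) (X : Op n) :
    F (proj S * X * proj S) = 0 := by
  have hdiag : ∀ w ∈ codeSpace S, F (Matrix.vecMulVec w (star w)) = 0 := by
    intro w hw
    set ρ := Matrix.vecMulVec w (star w) with hρ
    have hpos : ρ.PosSemidef := Matrix.posSemidef_vecMulVec_self_star w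
    by_cases ht : ρ.trace = 0
    · rw [hpos.trace_eq_zero_iff.mp ht, map_zero]
    · have htpos : 0 ≤ ρ.trace := hpos.trace_nonneg
      have hsupp : SupportedIn (codeSpace S) (ρ.trace⁻¹ • ρ) := by
        rw [supportedIn_codeSpace_iff, Matrix.mul_smul, hρ, Matrix.mul_vecMulVec,
          proj_mulVec_eq hw]
      have h0 := hF (ρ.trace⁻¹ • ρ)
        ⟨hpos.smul (inv_nonneg.mpr htpos), by
          rw [Matrix.trace_smul, smul_eq_mul, inv_mul_cancel₀ ht]⟩ hsupp
      rw [map_smul] at h0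
      exact (smul_eq_zero.mp h0).resolve_left (inv_ne_zero ht)
  have hoff : ∀ v ∈ codeSpace S, ∀ w ∈ codeSpace S, F (Matrix.vecMulVec v (star w)) = 0 := by
    intro v hv w hw
    -- Polarisation: `v + w` gives the sum of the two cross terms and `v + i w` gives `i` times
    -- their difference, up to sign; both vanish.
    have e1 := hdiag _ ((codeSpace S).add_mem hv hw)
    have e2 := hdiag _ ((codeSpace S).add_mem hv ((codeSpace S).smul_mem Complex.I hw))
    simp only [star_add, star_smul, Matrix.vecMulVec_add, Matrix.add_vecMulVec,
      Matrix.smul_vecMulVec, Matrix.vecMulVec_smul, map_add, map_smul, hdiag v hv,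
      hdiag w hw] at e1 e2
    simp only [zero_add, add_zero, smul_zero] at e1 e2
    have e3 : F (Matrix.vecMulVec w (star v)) = -F (Matrix.vecMulVec v (star w)) :=
      eq_neg_of_add_eq_zero_left e1
    rw [e3] at e2
    have e4 : (-(2 * Complex.I)) • F (Matrix.vecMulVec v (star w)) = 0 := by
      rw [← e2]
      simp only [RCLike.star_def, Complex.conj_I]
      module
    exact (smul_eq_zero.mp e4).resolve_left (by simp)
  have hX : proj S * X * proj S = ∑ x, ∑ y, X x y •
      Matrix.vecMulVec (proj S *ᵥ Pi.single x 1) (star (proj S *ᵥ Pi.single y 1)) := by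
    conv_lhs => rw [Matrix.matrix_eq_sum_single X]
    simp only [Finset.mul_sum, Finset.sum_mul]
    refine Finset.sum_congr rfl fun x _ => Finset.sum_congr rfl fun y _ => ?_
    rw [Matrix.star_mulVec, proj_conjTranspose, ← Matrix.vecMulVec_mul, ← Matrix.mul_vecMulVec,
      ← Matrix.smul_mul, ← Matrix.mul_smul]
    congr 2
    ext i j
    by_cases hi : i = x <;> by_cases hj : j = y <;>
      simp [Matrix.vecMulVec_apply, hi, hj, Ne.symm]
  rw [hX]
  simp only [map_sum, map_smul]
  refine Finset.sum_eq_zero fun x _ => Finset.sum_eq_zero fun y _ => ?_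
  rw [hoff _ (proj_mulVec_mem _) _ (proj_mulVec_mem _), smul_zero]

/-- The map `ρ ↦ K ρ Kᴴ`. -/
noncomputable def conjMap (K : Op n) : Op n →ₗ[ℂ] Op n :=
  LinearMap.mulRight ℂ Kᴴ ∘ₗ LinearMap.mulLeft ℂ K

theorem conjMap_apply (K ρ : Op n) : conjMap K ρ = K * ρ * Kᴴ := rfl

/-- The weight of the Kraus operator `H` in the restriction of `F` to operators `P X P`. -/
noncomputable def krausWeight (P H : Op n) (F : Op n →ₗ[ℂ] Op n) : ℂ :=
  ∑ x, ∑ y, (Hᴴ * F (P * Matrix.single x y 1 * P) * H) x y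

theorem krausWeight_sum_smul (P H : Op n) {ι : Type*} (s : Finset ι) (c : ι → ℂ)
    (F : ι → Op n →ₗ[ℂ] Op n) :
    krausWeight P H (∑ i ∈ s, c i • F i) = ∑ i ∈ s, c i * krausWeight P H (F i) := by
  simp only [krausWeight, LinearMap.sum_apply, LinearMap.smul_apply, Finset.mul_sum,
    Finset.sum_mul, Matrix.sum_apply, Matrix.mul_smul, Matrix.smul_mul, Matrix.smul_apply,
    smul_eq_mul]
  conv_rhs => rw [Finset.sum_comm]
  refine Finset.sum_congr rfl fun x _ => ?_
  rw [Finset.sum_comm]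

/-- With `B = Hᴴ K P`, the `(x, y)` entry of `B e_{xy} Bᴴ` is `B x x * star (B y y)`, so the sum
over all `x`, `y` factors as `|tr B|²`. -/
theorem krausWeight_conjMap (P H K : Op n) (hP : Pᴴ = P) :
    krausWeight P H (conjMap K) = (Hᴴ * K * P).trace * star (Hᴴ * K * P).trace := by
  have h : ∀ x y, Hᴴ * conjMap K (P * Matrix.single x y 1 * P) * H =
      (Hᴴ * K * P) * Matrix.single x y 1 * (Hᴴ * K * P)ᴴ := by
    intro x y
    simp only [conjMap_apply, Matrix.conjTranspose_mul, Matrix.conjTranspose_conjTranspose, hP,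
      mul_assoc]
  simp only [krausWeight, h]
  generalize Hᴴ * K * P = B
  rw [← Matrix.trace_conjTranspose, Matrix.trace, Matrix.trace, Finset.sum_mul_sum]
  refine Finset.sum_congr rfl fun x _ => Finset.sum_congr rfl fun y _ => ?_
  simp [Matrix.mul_apply, Matrix.single_apply, ite_and]

end Channels

/-! ### Sufficiency: the recovery channel -/

section Recovery

variable {S : Subgroup (pauliGroup n)}

/-- A choice of one error for each coset of the normaliser yields a recovery channel which undoes
the chosen error on every state of the code that an error in its coset has affected. -/
theorem exists_recovery (S : Subgroup (pauliGroup n)) (E : Set (pauliGroup n)) :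
    ∃ R : Op n →ₗ[ℂ] Op n, IsChannel R ∧ ∀ b ∈ E, ∃ a ∈ E,
      a⁻¹ * b ∈ Subgroup.normalizer (S : Set (pauliGroup n)) ∧
      ∀ ρ, IsDensity ρ → SupportedIn (codeSpace S) ρ →
        R (toOp b * ρ * (toOp b)ᴴ) = toOp (a⁻¹ * b) * ρ * (toOp (a⁻¹ * b))ᴴ := by
  classical
  set N := Subgroup.normalizer (S : Set (pauliGroup n))
  -- The syndromes: those cosets of the normaliser that contain an error.
  let Q := {q : pauliGroup n ⧸ N // ∃ a ∈ E, (a : pauliGroup n ⧸ N) = q}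
  let _ : Fintype Q := Fintype.ofFinite Q
  choose a haE haq using fun q : Q => q.2
  set P := proj S with hP
  have hne : ∀ q q' : Q, q ≠ q' → (a q)⁻¹ * a q' ∉ N := by
    intro q q' hqq h
    apply hqq
    apply Subtype.ext
    rw [← haq q, ← haq q', QuotientGroup.eq]
    exact h
  -- The projection onto the sum of the mutually orthogonal subspaces `a q C`.
  let W : Op n := ∑ q, toOp (a q) * P * (toOp (a q))ᴴ
  have hWs : Wᴴ = W := by
    simp only [W, Matrix.conjTranspose_sum, Matrix.conjTranspose_mul,
      Matrix.conjTranspose_conjTranspose, hP, proj_conjTranspose, mul_assoc]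
  have hWb : ∀ (q : Q) (b : pauliGroup n), (a q)⁻¹ * b ∈ N →
      W * (toOp b * P) = toOp b * P ∧ ∀ q', q' ≠ q → P * (toOp (a q'))ᴴ * (toOp b * P) = 0 := by
    intro q b hb
    have hz : ∀ q', q' ≠ q → P * (toOp (a q'))ᴴ * (toOp b * P) = 0 := by
      intro q' hq'
      have : (a q')⁻¹ * b ∉ N := fun h => hne q' q hq' (by
        have := N.mul_mem h (N.inv_mem hb)
        simpa [mul_assoc] using this)
      rw [← toOp_inv, ← mul_assoc, mul_assoc P, ← toOp_mul]
      exact proj_mul_toOp_mul_proj this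
    refine ⟨?_, hz⟩
    simp only [W, Finset.sum_mul]
    rw [Finset.sum_eq_single q]
    · rw [mul_assoc, mul_assoc, ← mul_assoc (toOp (a q))ᴴ, ← toOp_inv, ← toOp_mul,
        toOp_mul_proj_comm hb, ← mul_assoc P, proj_mul_self, ← toOp_mul_proj_comm hb,
        ← mul_assoc, ← toOp_mul, mul_inv_cancel_left]
    · intro q' _ hq'
      rw [mul_assoc (toOp (a q')), mul_assoc (toOp (a q')), hz q' hq', mul_zero]
    · simp
  have hWW : W * W = W := by
    conv_lhs => enter [2]; simp only [W]
    rw [Finset.mul_sum]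
    refine Finset.sum_congr rfl fun q _ => ?_
    rw [← mul_assoc, (hWb q (a q) (by simp [N.one_mem])).1]
  -- The index `none` carries the complement `1 - W`, which makes the map trace preserving and never
  -- fires on a corrupted code state.
  let K : Option Q → Op n := fun o => o.elim (1 - W) fun q => P * (toOp (a q))ᴴ
  have hK : ∑ o, (K o)ᴴ * K o = 1 := by
    rw [Fintype.sum_option]
    have h1 : ∀ q, (K (some q))ᴴ * K (some q) = toOp (a q) * P * (toOp (a q))ᴴ := by
      intro q
      simp only [K, Option.elim_some, Matrix.conjTranspose_mul,
        Matrix.conjTranspose_conjTranspose, hP, proj_conjTranspose]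
      rw [mul_assoc, ← mul_assoc (proj S), proj_mul_self, ← mul_assoc]
    rw [Finset.sum_congr rfl fun q _ => h1 q]
    change (1 - W)ᴴ * (1 - W) + W = 1
    rw [Matrix.conjTranspose_sub, Matrix.conjTranspose_one, hWs, mul_sub, sub_mul, sub_mul, hWW]
    simp
  refine ⟨∑ o, conjMap (K o), ?_, fun b hb => ?_⟩
  · have := isChannelWithKrausIn_of_fintype (T := Set.univ) K
      (fun o => ⟨1, K o, Set.mem_univ _, (one_smul _ _).symm⟩) hK
    have heq : ⇑(∑ o, conjMap (K o)) = fun ρ => ∑ o, K o * ρ * (K o)ᴴ := by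
      funext ρ
      rw [LinearMap.sum_apply]
      rfl
    rw [heq]
    exact this
  · let q : Q := ⟨(b : pauliGroup n ⧸ N), b, hb, rfl⟩
    have hq : (a q)⁻¹ * b ∈ N := QuotientGroup.eq.mp (haq q)
    refine ⟨a q, haE q, hq, fun ρ hρ hsupp => ?_⟩
    have hρP : P * ρ * P = ρ := by
      rw [hP, supportedIn_codeSpace_iff.mp hsupp, hsupp.mul_proj hρ.1.isHermitian]
    have hconj : ∀ L : Op n, L * (toOp b * ρ * (toOp b)ᴴ) * Lᴴ =
        (L * (toOp b * P)) * ρ * (L * (toOp b * P))ᴴ := by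
      intro L
      conv_lhs => rw [← hρP]
      simp only [Matrix.conjTranspose_mul, hP, proj_conjTranspose, mul_assoc]
    obtain ⟨hWq, hz⟩ := hWb q b hq
    rw [LinearMap.sum_apply]
    simp only [conjMap_apply, hconj]
    rw [Fintype.sum_option]
    have h0 : K none * (toOp b * P) = 0 := by
      change (1 - W) * (toOp b * P) = 0
      rw [sub_mul, hWq, one_mul, sub_self]
    rw [h0, Finset.sum_eq_single q]
    · have h1 : K (some q) * (toOp b * P) = toOp ((a q)⁻¹ * b) * P := by
        change P * (toOp (a q))ᴴ * (toOp b * P) = _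
        rw [← toOp_inv, mul_assoc, ← mul_assoc (toOp (a q)⁻¹), ← toOp_mul,
          toOp_mul_proj_comm hq, ← mul_assoc, proj_mul_self]
      rw [h1, Matrix.conjTranspose_mul, hP, proj_conjTranspose]
      conv_rhs => rw [← hρP]
      simp only [zero_mul, zero_add, mul_assoc, hP]
    · intro q' _ hq'
      have h1 : K (some q') * (toOp b * P) = 0 := hz q' hq'
      rw [h1, zero_mul, zero_mul]
    · simp

theorem isQETC_of_mem {E : Set (pauliGroup n)} {M : Subgroup (pauliGroup k)}
    (A : pauliGroup k ≃* LogicalQuotient S)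
    (h : ∀ a ∈ E, ∀ b ∈ E, a⁻¹ * b ∈ Subgroup.normalizer (S : Set (pauliGroup n)) →
      a⁻¹ * b ∈ upToPhase (lift S A (M : Set (pauliGroup k)))) :
    IsQETC S E (M : Set (pauliGroup k)) := by
  obtain ⟨R, hR, hRE⟩ := exists_recovery S E
  have hm : ∀ b ∈ E, ∃ m ∈ lift S A (M : Set (pauliGroup k)),
      ∀ ρ, IsDensity ρ → SupportedIn (codeSpace S) ρ →
        R (toOp b * ρ * (toOp b)ᴴ) = toOp m * ρ * (toOp m)ᴴ := by
    intro b hb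
    obtain ⟨a, ha, hab, hrec⟩ := hRE b hb
    obtain ⟨m, hm, c, hc, hcm⟩ := h a ha b hb hab
    refine ⟨m, hm, fun ρ hρ hs => ?_⟩
    rw [hrec ρ hρ hs, hcm, Matrix.conjTranspose_smul, Matrix.smul_mul, Matrix.smul_mul,
      Matrix.mul_smul, smul_smul, mul_comm c, IsPhase.star_mul_self_eq_one hc, one_smul]
  refine ⟨A, R, hR, fun N hN => ?_⟩
  obtain ⟨r, c, t, ht, hc, hNt⟩ := hN.exists_pauli
  choose m hmem hmR using fun i => hm (t i) (ht i)
  refine ⟨fun ρ => ∑ i, (c i • toOp (m i)) * ρ * (c i • toOp (m i))ᴴ, ⟨?_, ?_⟩, ?_⟩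
  · refine isChannelWithKrausIn_of_fintype _ (fun i => ⟨c i, _, ⟨m i, hmem i, rfl⟩, rfl⟩) ?_
    simp only [Matrix.conjTranspose_smul, smul_mul_smul_comm, toOp_conjTranspose_mul_self,
      ← Finset.sum_smul, hc, one_smul]
  · intro ρ _ hs v
    rw [Matrix.sum_mulVec]
    refine Submodule.sum_mem _ fun i _ => ?_
    rw [Matrix.conjTranspose_smul, Matrix.smul_mul, Matrix.smul_mul, Matrix.mul_smul, smul_smul,
      Matrix.smul_mulVec]
    exact Submodule.smul_mem _ _ (hs.conj (hmem i).1 v)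
  · intro ρ hρ hs
    rw [hNt, map_sum]
    refine Finset.sum_congr rfl fun i _ => ?_
    rw [map_smul, hmR i ρ hρ hs, Matrix.conjTranspose_smul, Matrix.smul_mul, Matrix.smul_mul,
      Matrix.mul_smul, smul_smul, mul_comm]

end Recovery

/-! ### Necessity: comparing the logical channels of two errors -/

theorem IsStabiliser.mem_upToPhase_of_recovery {S : Subgroup (pauliGroup n)}
    (hS : IsStabiliser n k S) {E : Set (pauliGroup n)} {M : Subgroup (pauliGroup k)}
    {A : pauliGroup k ≃* LogicalQuotient S} {R : Op n → Op n}
    (hR : ∀ N : Op n → Op n, IsChannelWithKrausIn (toOp '' E) N →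
      ∃ L : Op n → Op n, IsALNC S A (M : Set (pauliGroup k)) L ∧
        ∀ ρ, IsDensity ρ → SupportedIn (codeSpace S) ρ → R (N ρ) = L ρ)
    {a b : pauliGroup n} (ha : a ∈ E) (hb : b ∈ E)
    (hg : a⁻¹ * b ∈ Subgroup.normalizer (S : Set (pauliGroup n))) :
    a⁻¹ * b ∈ upToPhase (lift S A (M : Set (pauliGroup k))) := by
  obtain ⟨La, ⟨hLa, -⟩, hRa⟩ := hR _ (isChannelWithKrausIn_conj ha)
  obtain ⟨Lb, ⟨hLb, -⟩, hRb⟩ := hR _ (isChannelWithKrausIn_conj hb)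
  obtain ⟨r, c, t, ht, -, hLa⟩ := hLa.exists_pauli
  obtain ⟨r', d, u, hu, hd, hLb⟩ := hLb.exists_pauli
  obtain ⟨g, hgdef⟩ : ∃ g, g = a⁻¹ * b := ⟨_, rfl⟩
  rw [← hgdef] at hg ⊢
  have hbg : b = a * g := by simp [hgdef]
  -- `F` is the logical channel for `a` precomposed with conjugation by `g`; `G` is the one for `b`.
  let F : Op n →ₗ[ℂ] Op n := ∑ i, (star (c i) * c i) • conjMap (toOp (t i * g))
  let G : Op n →ₗ[ℂ] Op n := ∑ j, (star (d j) * d j) • conjMap (toOp (u j))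
  have hFG : ∀ X, (F - G) (proj S * X * proj S) = 0 := by
    refine eq_on_proj_mul_mul_proj _ fun ρ hρ hs => ?_
    have h1 := hRa _ (hρ.conj g) (hs.conj hg)
    have h2 := hRb ρ hρ hs
    have h3 : toOp a * (toOp g * ρ * (toOp g)ᴴ) * (toOp a)ᴴ = toOp b * ρ * (toOp b)ᴴ := by
      rw [hbg, toOp_mul, Matrix.conjTranspose_mul]
      simp only [mul_assoc]
    simp only [h3] at h1
    rw [h2, hLa, hLb] at h1
    rw [LinearMap.sub_apply, sub_eq_zero]
    simp only [F, G, LinearMap.sum_apply, LinearMap.smul_apply, conjMap_apply]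
    rw [h1]
    refine Finset.sum_congr rfl fun i _ => ?_
    rw [toOp_mul, Matrix.conjTranspose_mul]
    simp only [mul_assoc]
  have hw : ∀ H, krausWeight (proj S) H F = krausWeight (proj S) H G := by
    intro H
    simp only [krausWeight]
    refine Finset.sum_congr rfl fun x _ => Finset.sum_congr rfl fun y _ => ?_
    rw [sub_eq_zero.mp (hFG (Matrix.single x y 1))]
  have hj : ∃ j, d j ≠ 0 := by
    by_contra! h
    simp [h] at hd
  obtain ⟨j, hj⟩ := hj
  -- If every trace vanished, `u j` would have weight `0` in `F`, hence in `G`. All terms of the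
  -- weight in `G` are nonnegative, and the `j`-th is `|d j|² |tr P|²`, which is nonzero.
  have hi : ∃ i, ((toOp (u j))ᴴ * toOp (t i * g) * proj S).trace ≠ 0 := by
    by_contra! h
    have h1 := hw (toOp (u j))
    simp only [F, G, krausWeight_sum_smul, krausWeight_conjMap _ _ _ proj_conjTranspose, h,
      zero_mul, mul_zero, Finset.sum_const_zero] at h1
    have hnonneg : ∀ i ∈ Finset.univ, 0 ≤ star (d i) * d i *
        (((toOp (u j))ᴴ * toOp (u i) * proj S).trace *
          star ((toOp (u j))ᴴ * toOp (u i) * proj S).trace) := fun i _ =>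
      mul_nonneg (star_mul_self_nonneg _) (mul_star_self_nonneg _)
    have h2 := (Finset.sum_eq_zero_iff_of_nonneg hnonneg).mp h1.symm j (Finset.mem_univ j)
    rw [toOp_conjTranspose_mul_self, one_mul] at h2
    have h3 := hS.trace_proj_ne_zero
    simp [hj, h3] at h2
  obtain ⟨i, hi⟩ := hi
  rw [← toOp_inv, ← toOp_mul] at hi
  obtain ⟨s, hs, e, he, hes⟩ := exists_mem_of_trace_mul_proj_ne_zero hi
  rw [← coe_liftSubgroup]
  simp only [← coe_liftSubgroup] at ht hu
  have ht' : t i ∈ liftSubgroup S A M := ht i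
  have hu' : u j ∈ liftSubgroup S A M := hu j
  -- Solves `(u j)⁻¹ * t i * g = e • s` for `g`.
  refine ⟨(t i)⁻¹ * u j * s, Subgroup.mul_mem _ (Subgroup.mul_mem _ (Subgroup.inv_mem _ ht') hu')
    (le_liftSubgroup A M hs), e, he, ?_⟩
  rw [toOp_mul, ← Matrix.mul_smul, ← hes, ← toOp_mul]
  congr 1
  group

end QET

theorem mainTheorem1 {n k : ℕ} (S : Subgroup (QET.pauliGroup n)) (hS : QET.IsStabiliser n k S)
    (E : Set (QET.pauliGroup n)) (M : Subgroup (QET.pauliGroup k)) :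
    QET.IsQETC S E (M : Set (QET.pauliGroup k)) ↔
      ∃ A : QET.pauliGroup k ≃* QET.LogicalQuotient S, ∀ a ∈ E, ∀ b ∈ E,
        a⁻¹ * b ∈ ((Subgroup.normalizer (S : Set (QET.pauliGroup n)) : Set (QET.pauliGroup n)))ᶜ ∪
          QET.upToPhase (QET.lift S A (M : Set (QET.pauliGroup k))) := by
  constructor
  · rintro ⟨A, R, -, hR⟩
    refine ⟨A, fun a ha b hb => ?_⟩
    by_cases hg : a⁻¹ * b ∈ Subgroup.normalizer (S : Set (QET.pauliGroup n))
    · exact Or.inr (hS.mem_upToPhase_of_recovery hR ha hb hg)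
    · exact Or.inl hg
  · rintro ⟨A, h⟩
    exact QET.isQETC_of_mem A fun a ha b hb hg =>
      (h a ha b hb).resolve_left fun hn => hn hg
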